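/- Let $n$ and $m$ be positive integers and let $\epsilon\in\mathbb{C}$ be a primitive $n$-th root of unity. Let $$p_n(z; x_1,\dots,x_m) = \prod_{s_1,\dots,s_m=1}^{n}\left(\sqrt[n]{z}+\epsilon^{s_1}\sqrt[n]{x_1}+\dots+\epsilon^{s_m}\sqrt[n]{x_m}\right),$$ that is, let $p_n(z; x_1,\dots,x_m)\in\mathbb{C}[z,x_1,\dots,x_m]$ be the unique polynomial such that $$p_n(w^n; u_1^n,\dots,u_m^n)=\prod_{s_1,\dots,s_m=1}^{n}\left(w+\epsilon^{s_1}u_1+\dots+\epsilon^{s_m}u_m\right)$$ in $\mathbb{C}[w,u_1,\dots,u_m]$. Then $p_n(z; x_1,\dots,x_m)$ is irreducible over $\mathbb{C}$ as a polynomial in the variables $z, x_1,\dots,x_m$. -/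

import Mathlib

namespace PnPoly

open MvPolynomial

/-- The product `∏_{s₁,…,s_m} (w + ε^{s₁} u₁ + ⋯ + ε^{s_m} u_m)` in `ℂ[w, u₁, …, u_m]`, each `s_j`
running over a complete set of exponents mod `n`. The variable `X 0` is `w`, and `X j.succ` is
`u_{j+1}` for `j : Fin m`. -/
noncomputable def rootProduct (n m : ℕ) (ε : ℂ) : MvPolynomial (Fin (m + 1)) ℂ :=
  ∏ s : Fin m → Fin n, (X 0 + ∑ j : Fin m, C (ε ^ (s j : ℕ)) * X j.succ)

/-- Rescaling the variables: `X i ↦ v i * X i`. -/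
noncomputable def scale {σ : Type*} (v : σ → ℂ) : MvPolynomial σ ℂ →ₐ[ℂ] MvPolynomial σ ℂ :=
  aeval (fun i => C (v i) * X i)

theorem coeff_scale {σ : Type*} (v : σ → ℂ) (F : MvPolynomial σ ℂ) (d : σ →₀ ℕ) :
    coeff d (scale v F) = (d.prod fun i k => v i ^ k) * coeff d F := by
  classical
  induction F using MvPolynomial.induction_on' with
  | monomial e a =>
    have h : scale v (monomial e a) = monomial e ((e.prod fun i k => v i ^ k) * a) := by
      rw [scale, aeval_monomial]
      simp only [mul_pow, Finsupp.prod_mul, ← C_pow]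
      rw [monomial_eq (s := e) (a := _ * a), C_mul, algebraMap_eq]
      simp only [Finsupp.prod, map_prod]
      ring
    rw [h, coeff_monomial, coeff_monomial]
    split_ifs with hh
    · rw [hh]
    · simp
  | add p q hp hq => simp only [map_add, coeff_add, hp, hq, mul_add]

/-- A polynomial all of whose exponents are divisible by `n` is a polynomial in the `n`-th powers
of the variables. -/
theorem exists_expand {σ : Type*} (n : ℕ) (F : MvPolynomial σ ℂ)
    (h : ∀ d ∈ F.support, ∀ i, n ∣ d i) : ∃ P : MvPolynomial σ ℂ, expand n P = F := by
  refine ⟨∑ d ∈ F.support, monomial (d.mapRange (· / n) (Nat.zero_div n)) (coeff d F), ?_⟩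
  rw [map_sum]
  conv_rhs => rw [F.as_sum]
  refine Finset.sum_congr rfl fun d hd => ?_
  rw [expand_monomial]
  have : n • d.mapRange (· / n) (Nat.zero_div n) = d := by
    ext i
    simpa using Nat.mul_div_cancel' (h d hd i)
  rw [this]

theorem scale_rootProduct_shift (n m : ℕ) (ε : ℂ) (hε : IsPrimitiveRoot ε n) (hn : 0 < n)
    (j : Fin m) :
    scale (Function.update 1 j.succ ε) (rootProduct n m ε) = rootProduct n m ε := by
  classical
  have : NeZero n := ⟨hn.ne'⟩
  have hpow : ∀ a : Fin n, ε ^ ((a + 1 : Fin n) : ℕ) = ε ^ (a : ℕ) * ε := by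
    intro a
    rw [← pow_succ, Fin.val_add, Fin.val_one', Nat.add_mod_mod]
    conv_rhs => rw [← Nat.div_add_mod (a + 1 : ℕ) n, pow_add, pow_mul, hε.pow_eq_one, one_pow,
      one_mul]
  rw [rootProduct, map_prod]
  refine Fintype.prod_equiv (Equiv.addRight (Pi.single j (1 : Fin n))) _ _ fun s => ?_
  simp only [scale, map_add, map_sum, map_mul, aeval_X, aeval_C, algebraMap_eq,
    Equiv.coe_addRight, Pi.add_apply]
  congr 1
  · rw [Function.update_of_ne (Fin.succ_ne_zero j).symm]
    simp
  · refine Finset.sum_congr rfl fun k _ => ?_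
    by_cases hk : k = j
    · subst hk
      rw [Function.update_self, Pi.single_eq_same, hpow, C_mul, mul_assoc]
    · rw [Function.update_of_ne (by simpa using hk), Pi.single_eq_of_ne hk]
      simp

theorem scale_rootProduct_const (n m : ℕ) (ε : ℂ) (hε : IsPrimitiveRoot ε n) (hm : 0 < m) :
    scale (fun _ => ε) (rootProduct n m ε) = rootProduct n m ε := by
  have h : ∀ s : Fin m → Fin n,
      scale (fun _ => ε) (X 0 + ∑ j : Fin m, C (ε ^ (s j : ℕ)) * X j.succ)
        = C ε * (X 0 + ∑ j : Fin m, C (ε ^ (s j : ℕ)) * X j.succ) := by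
    intro s
    simp only [scale, map_add, map_sum, map_mul, aeval_X, aeval_C, algebraMap_eq, mul_add,
      Finset.mul_sum]
    congr 1
    exact Finset.sum_congr rfl fun k _ => by ring
  have h1 : ε ^ n ^ m = 1 := (hε.pow_eq_one_iff_dvd _).2 (dvd_pow_self n hm.ne')
  rw [rootProduct, map_prod, Finset.prod_congr rfl fun s _ => h s, Finset.prod_mul_distrib,
    Finset.prod_const, ← C_pow]
  simp [h1]

/-- The product is a polynomial in the `n`-th powers of the variables, in exactly one way. -/
theorem existsUnique_pn (n m : ℕ) (hn : 0 < n) (hm : 0 < m) (ε : ℂ) (hε : IsPrimitiveRoot ε n) :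
    ∃! P : MvPolynomial (Fin (m + 1)) ℂ, expand n P = rootProduct n m ε := by
  classical
  refine existsUnique_of_exists_of_unique (exists_expand n _ fun d hd => ?_)
    fun P Q hP hQ => expand_injective hn (hP.trans hQ.symm)
  rw [mem_support_iff] at hd
  have key : ∀ v : Fin (m + 1) → ℂ, scale v (rootProduct n m ε) = rootProduct n m ε →
      ∏ i, v i ^ d i = 1 := by
    intro v hv
    have := coeff_scale v (rootProduct n m ε) d
    rw [hv, Finsupp.prod_fintype _ _ (by simp)] at this
    exact (mul_eq_right₀ hd).1 this.symm
  have hs : ∀ j : Fin m, n ∣ d j.succ := by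
    intro j
    have := key _ (scale_rootProduct_shift n m ε hε hn j)
    rw [Finset.prod_eq_single j.succ (fun i _ hi => by simp [Function.update_of_ne hi])
      (by simp), Function.update_self] at this
    exact (hε.pow_eq_one_iff_dvd _).1 this
  have h0 := key _ (scale_rootProduct_const n m ε hε hm)
  rw [Finset.prod_pow_eq_pow_sum, hε.pow_eq_one_iff_dvd, Fin.sum_univ_succ] at h0
  intro i
  refine Fin.cases ?_ hs i
  exact (Nat.dvd_add_left (Finset.dvd_sum fun j _ => hs j)).1 h0

/-- `p_n(z; x₁, …, x_m) = ∏_{s₁,…,s_m} (z^{1/n} + ε^{s₁} x₁^{1/n} + ⋯ + ε^{s_m} x_m^{1/n})`, as a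
polynomial in `z = X 0` and `x_{j+1} = X j.succ`: the unique polynomial which becomes
`∏ (w + ε^{s₁} u₁ + ⋯ + ε^{s_m} u_m)` under the substitution `z = w ^ n`, `x_j = u_j ^ n`. -/
noncomputable def pn (n m : ℕ) (hn : 0 < n) (hm : 0 < m) (ε : ℂ) (hε : IsPrimitiveRoot ε n) :
    MvPolynomial (Fin (m + 1)) ℂ :=
  (existsUnique_pn n m hn hm ε hε).choose

theorem expand_pn (n m : ℕ) (hn : 0 < n) (hm : 0 < m) (ε : ℂ) (hε : IsPrimitiveRoot ε n) :
    expand n (pn n m hn hm ε hε) = rootProduct n m ε :=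
  (existsUnique_pn n m hn hm ε hε).choose_spec.1

end PnPoly

namespace PnPoly

open MvPolynomial

/-- The linear form `w + ε^{s₁} u₁ + ⋯ + ε^{s_m} u_m`. -/
noncomputable def linearFactor {n m : ℕ} (ε : ℂ) (s : Fin m → Fin n) :
    MvPolynomial (Fin (m + 1)) ℂ :=
  X 0 + ∑ j : Fin m, C (ε ^ (s j : ℕ)) * X j.succ

theorem coeff_zero_linearFactor {n m : ℕ} (ε : ℂ) (s : Fin m → Fin n) :
    coeff (Finsupp.single 0 1) (linearFactor ε s) = 1 := by
  classical
  simp only [linearFactor, coeff_add, coeff_sum, coeff_C_mul, coeff_X]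
  simp [Finsupp.single_left_inj]

theorem coeff_succ_linearFactor {n m : ℕ} (ε : ℂ) (s : Fin m → Fin n) (j : Fin m) :
    coeff (Finsupp.single j.succ 1) (linearFactor ε s) = ε ^ (s j : ℕ) := by
  classical
  simp only [linearFactor, coeff_add, coeff_sum, coeff_C_mul, coeff_X]
  simp [Finsupp.single_left_inj, (Fin.succ_ne_zero _).symm]

theorem linearFactor_ne_zero {n m : ℕ} (ε : ℂ) (s : Fin m → Fin n) : linearFactor ε s ≠ 0 := by
  intro h
  simpa [h] using coeff_zero_linearFactor ε s

theorem irreducible_linearFactor {n m : ℕ} (ε : ℂ) (s : Fin m → Fin n) :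
    Irreducible (linearFactor ε s) := by
  have hom : (linearFactor ε s).IsHomogeneous 1 := by
    refine (isHomogeneous_X ℂ 0).add (IsHomogeneous.sum _ _ _ fun j _ => ?_)
    simpa using (isHomogeneous_C (Fin (m + 1)) (ε ^ (s j : ℕ))).mul (isHomogeneous_X ℂ j.succ)
  refine irreducible_of_totalDegree_eq_one (hom.totalDegree (linearFactor_ne_zero ε s))
    fun x hx => isUnit_of_dvd_one ?_
  simpa only [coeff_zero_linearFactor] using hx (Finsupp.single 0 1)

theorem eq_of_linearFactor_dvd {n m : ℕ} {ε : ℂ} (hε : IsPrimitiveRoot ε n)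
    {s t : Fin m → Fin n} (h : linearFactor ε s ∣ linearFactor ε t) : s = t := by
  obtain ⟨u, hu⟩ := (irreducible_linearFactor ε s).dvd_irreducible_iff_associated
    (irreducible_linearFactor ε t) |>.1 h
  obtain ⟨c, -, hc⟩ := isUnit_iff_eq_C_of_isReduced.1 u.isUnit
  rw [hc, mul_comm] at hu
  have hc1 : c = 1 := by
    simpa [coeff_C_mul, coeff_zero_linearFactor] using congrArg (coeff (Finsupp.single 0 1)) hu
  rw [hc1, C_1, one_mul] at hu
  funext j
  have := congrArg (coeff (Finsupp.single j.succ 1)) hu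
  rw [coeff_succ_linearFactor, coeff_succ_linearFactor] at this
  exact Fin.ext (hε.pow_inj (s j).2 (t j).2 this)

/-- Polynomials in the `n`-th powers of the variables are fixed by scaling by roots of unity. -/
theorem scale_expand {σ : Type*} {n : ℕ} {v : σ → ℂ} (hv : ∀ i, v i ^ n = 1)
    (A : MvPolynomial σ ℂ) : scale v (expand n A) = expand n A := by
  have : (scale v).comp (expand n) = expand n := by
    ext1 i
    simp [scale, mul_pow, ← C_pow, hv]
  exact DFunLike.congr_fun this A

theorem linearFactor_dvd_expand {n m : ℕ} {ε : ℂ} (hε : IsPrimitiveRoot ε n) (hn : 0 < n)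
    {A : MvPolynomial (Fin (m + 1)) ℂ} {s : Fin m → Fin n}
    (h : linearFactor ε s ∣ expand n A) (t : Fin m → Fin n) : linearFactor ε t ∣ expand n A := by
  set v : Fin (m + 1) → ℂ := Fin.cons 1 fun j => ε ^ (t j : ℕ) / ε ^ (s j : ℕ) with hv
  have hvn : ∀ i, v i ^ n = 1 := by
    intro i
    refine Fin.cases (by simp [hv]) (fun j => ?_) i
    simp [hv, div_pow, ← pow_mul, mul_comm _ n, pow_mul ε n, hε.pow_eq_one]
  have hst : scale v (linearFactor ε s) = linearFactor ε t := by
    simp only [linearFactor, scale, map_add, map_sum, map_mul, aeval_X, aeval_C, algebraMap_eq]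
    congr 1
    · simp [hv]
    · refine Finset.sum_congr rfl fun j _ => ?_
      rw [← mul_assoc, ← C_mul, hv, Fin.cons_succ,
        mul_div_cancel₀ _ (pow_ne_zero _ (hε.ne_zero hn.ne'))]
  rw [← hst, ← scale_expand hvn A]
  exact map_dvd (scale v) h

theorem rootProduct_dvd_expand {n m : ℕ} {ε : ℂ} (hε : IsPrimitiveRoot ε n) (hn : 0 < n)
    {A : MvPolynomial (Fin (m + 1)) ℂ} {s : Fin m → Fin n}
    (h : linearFactor ε s ∣ expand n A) : rootProduct n m ε ∣ expand n A :=
  Fintype.prod_dvd_of_isRelPrime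
    (fun t _ hne => (irreducible_linearFactor ε t).isRelPrime_iff_not_dvd.2
      fun hd => hne (eq_of_linearFactor_dvd hε hd))
    (linearFactor_dvd_expand hε hn h)

theorem rootProduct_ne_zero (n m : ℕ) (ε : ℂ) : rootProduct n m ε ≠ 0 :=
  Finset.prod_ne_zero_iff.2 fun s _ => linearFactor_ne_zero ε s

theorem isUnit_of_expand_mul_eq_rootProduct {n m : ℕ} {ε : ℂ} (hε : IsPrimitiveRoot ε n)
    (hn : 0 < n) {A B : MvPolynomial (Fin (m + 1)) ℂ} {s : Fin m → Fin n}
    (hAB : expand n A * expand n B = rootProduct n m ε)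
    (h : linearFactor ε s ∣ expand n A) : IsUnit B := by
  have := isLocalHom_expand (R := ℂ) (σ := Fin (m + 1)) hn.ne'
  refine IsUnit.of_map (expand n) B (isUnit_of_dvd_one ?_)
  have hA : expand n A ≠ 0 := left_ne_zero_of_mul (hAB ▸ rootProduct_ne_zero n m ε)
  refine (mul_dvd_mul_iff_left hA).1 ?_
  rw [hAB, mul_one]
  exact rootProduct_dvd_expand hε hn h

end PnPoly

open PnPoly MvPolynomial

theorem mainTheorem4 (n m : ℕ) (hn : 0 < n) (hm : 0 < m) (ε : ℂ) (hε : IsPrimitiveRoot ε n) :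
    Irreducible (PnPoly.pn n m hn hm ε hε) := by
  have hdvd : linearFactor ε (fun _ : Fin m => (⟨0, hn⟩ : Fin n)) ∣ rootProduct n m ε :=
    Finset.dvd_prod_of_mem (linearFactor ε) (Finset.mem_univ _)
  refine ⟨fun hu => ?_, fun A B hAB => ?_⟩
  · have hu' := hu.map (expand n)
    rw [expand_pn] at hu'
    exact (irreducible_linearFactor ε _).not_isUnit (isUnit_of_dvd_unit hdvd hu')
  · have hprod : expand n A * expand n B = rootProduct n m ε := by
      rw [← map_mul, ← hAB, expand_pn]
    rcases (irreducible_linearFactor ε fun _ : Fin m => (⟨0, hn⟩ : Fin n)).prime.dvd_or_dvd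
        (hprod ▸ hdvd) with h | h
    · exact Or.inr (isUnit_of_expand_mul_eq_rootProduct hε hn hprod h)
    · exact Or.inl (isUnit_of_expand_mul_eq_rootProduct hε hn ((mul_comm _ _).trans hprod) h)
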